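/- Let $\Bbbk$ be an algebraically closed field. An abelian $\Bbbk$-linear category is artinian if all its objects have finite length and all its Hom spaces are finite-dimensional; a tensor category $\mathcal C$ over $\Bbbk$ is a rigid monoidal artinian category over $\Bbbk$ whose tensor product is $\Bbbk$-bilinear on morphisms and whose unit object satisfies $\operatorname{End}(\mathbf 1)=\Bbbk$. It is Frobenius if each simple object has an injective hull. Write $\ell(X)$ for the length of $X$, $[X:S]$ for the multiplicity of a simple object $S$ in a composition series of $X$, $X^*$ for the dual of $X$ with evaluation $X^*\otimes X\to\mathbf 1$ and coevaluation $\mathbf 1\to X\otimes X^*$, and $E(X)$ for the injective hull of $X$. The category $\mathcal C$ has subexponential growth if for every object $X$ there is a real constant $K\ge 1$ with $\ell(X^{\otimes n})\le K^n$ for all sufficiently large $n$; the infimum of such $K$ is denoted by $\rho(X)$. The Loewy length $\ell\ell(X)$ is the least $m\ge 0$ with $\operatorname{Soc}^m(X)=X$, where $\operatorname{Soc}^0(X)=0$ and $\operatorname{Soc}^{m+1}(X)/\operatorname{Soc}^m(X)$ is the socle of $X/\operatorname{Soc}^m(X)$. The coradical filtration of $\mathcal C$ is $(\mathcal C_n)_{n\ge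 0}$, where $\mathcal C_n$ is the full subcategory of objects of Loewy length at most $n+1$; it is finite if $\mathcal C_n=\mathcal C$ for some $n$. The Loewy length of $\mathcal C$ is $\sup_{X\in\mathcal C}\ell\ell(X)$. **Theorem.** Let $\mathcal C$ be a Frobenius tensor category over $\Bbbk$ of subexponential growth. Then the coradical filtration of $\mathcal C$ is finite. More precisely, the injective hull $E(\mathbf 1)$ of the unit object exists and, if $\{S_i\}_{i\in I}$ is a full set of representatives of the isomorphism classes of simple objects of $\mathcal C$, then only finitely many of the multiplicities $[E(\mathbf 1):S_i]$ are nonzero, and the Loewy length of $\mathcal C$ is finite and does not exceed $$\sum_{i\in I}\,[E(\mathbf 1):S_i]\;\rho\bigl(S_i\otimes E(\mathbf 1)\otimes S_i^*\bigr).$$ -/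

import Mathlib

open CategoryTheory Limits MonoidalCategory

universe w v u

namespace FrobeniusTensor

section Lengths

variable {C : Type u} [Category.{v} C] [Abelian C]

/-- A composition series of `X`: a finite chain of subobjects from `0` to `X`
whose successive quotients are simple. -/
structure CompSeries (X : C) where
  length : ℕ
  obj : Fin (length + 1) → Subobject X
  bot : obj 0 = ⊥
  top : obj (Fin.last length) = ⊤
  le : ∀ i : Fin length, obj i.castSucc ≤ obj i.succ
  simple : ∀ i : Fin length, Simple (cokernel (Subobject.ofLE _ _ (le i)))

/-- The `i`-th composition factor of a composition series. -/
noncomputable def CompSeries.factor {X : C} (s : CompSeries X) (i : Fin s.length) : C :=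
  cokernel (Subobject.ofLE _ _ (s.le i))

/-- `X` has finite length if it has a composition series. -/
def HasFiniteLength (X : C) : Prop := Nonempty (CompSeries X)

open Classical in
/-- The length `ℓ(X)` of an object of finite length: the length of a composition series of `X`
(any one, by Jordan-Hölder). The value at objects of infinite length is irrelevant. -/
noncomputable def length (X : C) : ℕ :=
  if h : HasFiniteLength X then (Classical.choice h).length else 0

open Classical in
/-- The multiplicity `[X : S]`: the number of occurrences of `S` up to isomorphism in a composition
series of `X` (any one, by Jordan-Hölder). The value at objects of infinite length is irrelevant. -/
noncomputable def multiplicity (X S : C) : ℕ :=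
  if h : HasFiniteLength X then
    Nat.card {i : Fin (Classical.choice h).length //
      Nonempty ((Classical.choice h).factor i ≅ S)}
  else 0

open Classical in
/-- The socle of `X`: the sum, that is, the least upper bound in the lattice of subobjects, of all
simple subobjects of `X`. It exists whenever `X` has finite length. -/
noncomputable def socle (X : C) : Subobject X :=
  if h : ∃ U : Subobject X, IsLUB {V : Subobject X | Simple (V : C)} U then h.choose else ⊥

/-- The Loewy series: `Soc⁰ X = 0`, and `Socⁿ⁺¹ X` is the preimage in `X` of the socle of
`X / Socⁿ X`. -/
noncomputable def loewySeries (X : C) : ℕ → Subobject X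
  | 0 => ⊥
  | n + 1 => (Subobject.pullback (cokernel.π (loewySeries X n).arrow)).obj
      (socle (cokernel (loewySeries X n).arrow))

/-- The Loewy length of `X`: the least `m` with `Socᵐ X = X`, and `∞` if there is none. -/
noncomputable def loewyLength (X : C) : ℕ∞ :=
  ⨅ (m : ℕ) (_ : loewySeries X m = ⊤), (m : ℕ∞)

/-- `i : X ⟶ E` is an injective hull of `X`: an essential monomorphism into an injective object. -/
structure IsInjectiveHull {X E : C} (i : X ⟶ E) : Prop where
  mono : Mono i
  injective : Injective E
  essential : ∀ ⦃Y : C⦄ (f : E ⟶ Y), Mono (i ≫ f) → Mono f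

/-- `S` is a full set of representatives of the simple objects up to isomorphism. -/
structure IsSimpleRepresentatives {I : Type*} (S : I → C) : Prop where
  simple : ∀ i, Simple (S i)
  existsUnique : ∀ T : C, Simple T → ∃! i, Nonempty (T ≅ S i)

end Lengths

section Categories

variable (C : Type u) [Category.{v} C] [Abelian C]

/-- The `n`-th member of the coradical filtration: the full subcategory of the objects of Loewy
length at most `n + 1`. -/
def coradicalFiltration (n : ℕ) : ObjectProperty C := fun X => loewyLength X ≤ (n : ℕ∞) + 1

/-- The coradical filtration is finite if one of its members is the whole category. -/
def CoradicalFiltrationFinite : Prop := ∃ n : ℕ, ∀ X : C, coradicalFiltration C n X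

/-- The Loewy length of the category: the supremum of the Loewy lengths of its objects. For a nonzero
category it is the number of members up to the first one that is everything. -/
noncomputable def categoryLoewyLength : ℕ∞ := ⨆ X : C, loewyLength X

/-- A category all of whose simple objects have injective hulls. -/
def HasSimpleInjectiveHulls : Prop :=
  ∀ S : C, Simple S → ∃ (E : C) (i : S ⟶ E), IsInjectiveHull i

/-- Artinian (that is, locally finite) `k`-linear abelian categories: objects have finite length and
`Hom` spaces are finite-dimensional. -/
class IsArtinianCategory (k : Type w) [Field k] [Linear k C] : Prop where
  finite_length : ∀ X : C, HasFiniteLength X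
  finite_hom : ∀ X Y : C, FiniteDimensional k (X ⟶ Y)

/-- Tensor categories over `k`: rigid monoidal artinian categories over `k` whose tensor product is
`k`-bilinear on morphisms and with `End(𝟙) = k`. -/
class IsTensorCategory (k : Type w) [Field k] [Linear k C] [MonoidalCategory C]
    [MonoidalPreadditive C] [MonoidalLinear k C] [RigidCategory C] : Prop
    extends IsArtinianCategory C k where
  end_unit : Function.Bijective (fun c : k => c • 𝟙 (𝟙_ C))

/-- Frobenius tensor categories: tensor categories in which each simple object has an
injective hull. -/
class IsFrobeniusTensorCategory (k : Type w) [Field k] [Linear k C] [MonoidalCategory C]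
    [MonoidalPreadditive C] [MonoidalLinear k C] [RigidCategory C] : Prop
    extends IsTensorCategory C k where
  injective_hulls : HasSimpleInjectiveHulls C

end Categories

section Growth

variable {C : Type u} [Category.{v} C] [Abelian C] [MonoidalCategory C]

/-- The tensor power `X^{⊗n}`. -/
def tensorPow (X : C) : ℕ → C
  | 0 => 𝟙_ C
  | n + 1 => tensorPow X n ⊗ X

/-- The numbers `K ≥ 1` such that `ℓ(X^{⊗n}) ≤ Kⁿ` for large enough `n`. -/
def growthBounds (X : C) : Set ℝ :=
  {K : ℝ | 1 ≤ K ∧ ∀ᶠ n : ℕ in Filter.atTop, (length (tensorPow X n) : ℝ) ≤ K ^ n}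

/-- The spectral radius `ρ(X)`. -/
noncomputable def spectralRadius (X : C) : ℝ := sInf (growthBounds X)

variable (C) in
/-- Subexponential growth: every object `X` admits a `K ≥ 1` such that `ℓ(X^{⊗n}) ≤ Kⁿ` for large
enough `n`. -/
def HasSubexponentialGrowth : Prop := ∀ X : C, (growthBounds X).Nonempty

end Growth

end FrobeniusTensor

/-!
Let `E` be an injective object containing the unit object. Since tensoring is exact and has adjoints
on both sides, `X ⊗ E` is injective for every `X`, and it contains `X`.

The heart of the argument is that for simple `S` the length `n` of `W = S ⊗ T` is at most
`ρ(A)`, where `A = (T ⊗ E) ⊗ T^*`; the bound does not depend on `S` (`length_le_spectralRadius`).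
The functor `Y ↦ Hom(W, (Y ⊗ T) ⊗ E)` is exact, because short exact sequences become split after
tensoring with `E`. Every composition factor `F` of `W` admits a nonzero morphism `W ⟶ F ⊗ E`, so
the functor has dimension at least `n` at `Y = S`, hence at least `n · dim Hom(S, Y)` at any `Y`. By
adjunction its value is `Hom(S, Y ⊗ A)`. Iterating from `Y = S` gives
`n ^ m ≤ dim Hom(S, S ⊗ A^{⊗m}) = dim Hom(S^* ⊗ S, A^{⊗m}) ≤ ℓ(S^* ⊗ S) · ℓ(A^{⊗m})`
(`pow_length_le_finrank`), and the first factor does not depend on `m`.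

Consequently `S ⊗ E`, for `S` simple, has length at most the sum of `ρ((T ⊗ E) ⊗ T^*)` over the
composition factors `T` of `E`. By the horseshoe construction every object embeds into a finite
direct sum of such injective objects, and the property of having a filtration of given length with
semisimple quotients passes to direct sums and subobjects (`hasLoewyFiltration_of_simple`).
Such a filtration bounds the Loewy length (`HasLoewyFiltration.loewyLength_le`).

No Jordan-Hölder theorem is needed: every estimate is made along an arbitrary composition series, by
`CompSeries.devissage`. The unit object has an injective hull because it is simple (`simple_unit`).
-/

namespace FrobeniusTensor

/-! ### Semisimple objects -/

section Semisimple

variable {C : Type u} [Category.{v} C]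

/-- An object is semisimple if all its subobjects are direct summands. -/
def IsSemisimple (X : C) : Prop := ∀ ⦃B : C⦄ (i : B ⟶ X) [Mono i], IsSplitMono i

theorem IsSemisimple.of_mono {X Y : C} (hY : IsSemisimple Y) (f : X ⟶ Y) [Mono f] :
    IsSemisimple X := by
  intro B i _
  obtain ⟨⟨r, hr⟩⟩ := hY (i ≫ f)
  exact ⟨⟨f ≫ r, by rw [← Category.assoc, hr]⟩⟩

end Semisimple

section Abelian

open ZeroObject

variable {C : Type u} [Category.{v} C] [Abelian C]

/-! ### Dévissage along composition series -/

theorem CompSeries.shortExact {X : C} (s : CompSeries X) (i : Fin s.length) :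
    (ShortComplex.mk (Subobject.ofLE _ _ (s.le i)) (cokernel.π _)
      (cokernel.condition _)).ShortExact where
  exact := ShortComplex.exact_cokernel _
  mono_f := inferInstanceAs (Mono (Subobject.ofLE _ _ (s.le i)))
  epi_g := inferInstanceAs (Epi (cokernel.π (Subobject.ofLE _ _ (s.le i))))

/-- A relation between objects and natural numbers that holds between zero objects and `0` and is
additive along short exact sequences may be verified on the factors of a composition series. -/
theorem CompSeries.devissage {R : C → ℕ → Prop} (zero : ∀ X, IsZero X → R X 0)
    (ext : ∀ T : ShortComplex C, T.ShortExact → ∀ a b, R T.X₁ a → R T.X₃ b → R T.X₂ (a + b))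
    {X : C} (s : CompSeries X) (n : Fin s.length → ℕ) (h : ∀ i, R (s.factor i) (n i)) :
    R X (∑ i, n i) := by
  have key : ∀ j (hj : j < s.length + 1), R (s.obj ⟨j, hj⟩ : C)
      (∑ i ∈ Finset.range j, if hi : i < s.length then n ⟨i, hi⟩ else 0) := by
    intro j
    induction j with
    | zero =>
      intro hj
      have : s.obj ⟨0, hj⟩ = ⊥ := s.bot
      rw [this]
      exact zero _ ((isZero_zero C).of_iso Subobject.botCoeIsoZero)
    | succ j ih =>
      intro hj
      rw [Finset.sum_range_succ, dif_pos (Nat.lt_of_succ_lt_succ hj)]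
      exact ext _ (s.shortExact ⟨j, Nat.lt_of_succ_lt_succ hj⟩) _ _ (ih _) (h _)
  have h1 := key s.length (Nat.lt_succ_self _)
  have hsum : ∑ i, n i =
      ∑ i ∈ Finset.range s.length, if hi : i < s.length then n ⟨i, hi⟩ else 0 := by
    rw [← Fin.sum_univ_eq_sum_range
      (fun i => if hi : i < s.length then n ⟨i, hi⟩ else 0) s.length]
    simp
  have htop : s.obj ⟨s.length, Nat.lt_succ_self _⟩ = ⊤ := s.top
  rw [hsum]
  have hiso : IsIso (s.obj ⟨s.length, Nat.lt_succ_self _⟩).arrow :=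
    (Subobject.isIso_arrow_iff_eq_top _).2 htop
  let T := ShortComplex.mk (s.obj ⟨s.length, Nat.lt_succ_self _⟩).arrow (0 : X ⟶ (0 : C)) comp_zero
  have hT : T.ShortExact :=
    { exact := (ShortComplex.exact_iff_epi T rfl).2 (inferInstanceAs (Epi (Subobject.arrow _)))
      mono_f := inferInstanceAs (Mono (Subobject.arrow _))
      epi_g := inferInstanceAs (Epi (0 : X ⟶ (0 : C))) }
  exact ext T hT _ 0 h1 (zero _ (isZero_zero C))

theorem HasFiniteLength.induction {P : C → Prop} (zero : ∀ X, IsZero X → P X)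
    (simple : ∀ X, Simple X → P X)
    (ext : ∀ T : ShortComplex C, T.ShortExact → P T.X₁ → P T.X₃ → P T.X₂)
    {X : C} (h : HasFiniteLength X) : P X :=
  h.elim fun s => s.devissage (R := fun X _ => P X) zero (fun T hT _ _ => ext T hT) (fun _ => 0)
    fun i => simple _ (s.simple i)

/-! ### Chain conditions -/

/-- Nested subobjects of the middle term of a short exact sequence are equal if they have the same
intersection with `X₁` and the same image in `X₃`. -/
theorem subobject_eq_of_pullback_le_of_image_le {T : ShortComplex C} (hT : T.ShortExact)
    {V V' : Subobject T.X₂} (h : V ≤ V')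
    (h₁ : (Subobject.pullback T.f).obj V' ≤ (Subobject.pullback T.f).obj V)
    (h₃ : imageSubobject (V'.arrow ≫ T.g) ≤ imageSubobject (V.arrow ≫ T.g)) : V = V' := by
  have := hT.mono_f
  let u := Subobject.ofLE _ _ h
  let q := cokernel.π u
  let p := factorThruImageSubobject (V'.arrow ≫ T.g)
  have hu : u ≫ V'.arrow = V.arrow := Subobject.ofLE_arrow h
  have hp : p ≫ (imageSubobject (V'.arrow ≫ T.g)).arrow = V'.arrow ≫ T.g :=
    imageSubobject_arrow_comp _
  -- `q` vanishes on `V' ∩ X₁`, which is the kernel of `p`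
  have hk : kernel.ι p ≫ q = 0 := by
    have hz : (kernel.ι p ≫ V'.arrow) ≫ T.g = 0 := by
      have h0 := congrArg (kernel.ι p ≫ ·) hp
      rw [Category.assoc, ← h0, kernel.condition_assoc, zero_comp]
    let l := hT.exact.lift _ hz
    have hl : l ≫ T.f = kernel.ι p ≫ V'.arrow := hT.exact.lift_f _ hz
    have h' : V'.Factors (l ≫ T.f) := by
      rw [hl]; exact Subobject.factors_comp_arrow _
    have h2 : V.Factors (l ≫ T.f) := (pullback_factors_iff _ _ _).1
      (Subobject.factors_of_le _ h₁ ((pullback_factors_iff _ _ _).2 h'))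
    have h4 : kernel.ι p = V.factorThru _ h2 ≫ u := by
      rw [← cancel_mono V'.arrow, Category.assoc, hu, Subobject.factorThru_arrow, hl]
    rw [h4, Category.assoc, cokernel.condition, comp_zero]
  have hle : imageSubobject (V.arrow ≫ T.g) ≤ imageSubobject (V'.arrow ≫ T.g) := by
    refine imageSubobject_le _ (u ≫ p) ?_
    rw [Category.assoc, hp, reassoc_of% hu]
  have : IsIso (Subobject.ofLE _ _ hle) :=
    ⟨Subobject.ofLE _ _ h₃, by simp [Subobject.ofLE_comp_ofLE], by simp [Subobject.ofLE_comp_ofLE]⟩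
  have hup : u ≫ p = factorThruImageSubobject (V.arrow ≫ T.g) ≫ Subobject.ofLE _ _ hle := by
    rw [← cancel_mono (imageSubobject (V'.arrow ≫ T.g)).arrow, Category.assoc, hp,
      reassoc_of% hu, Category.assoc, Subobject.ofLE_arrow, imageSubobject_arrow_comp]
  have hq' : Abelian.epiDesc p q hk = 0 := by
    have : Epi (u ≫ p) := by rw [hup]; infer_instance
    rw [← cancel_epi (u ≫ p), Category.assoc, Abelian.comp_epiDesc, cokernel.condition, comp_zero]
  have hq : q = 0 := by
    have := Abelian.comp_epiDesc p q hk
    rw [← this, hq', comp_zero]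
  have : Epi u := Preadditive.epi_of_cokernel_zero hq
  have : IsIso u := isIso_of_mono_of_epi u
  exact le_antisymm h (Subobject.le_of_comm (inv u) (by rw [IsIso.inv_comp_eq, hu]))

/-- The pair of the intersection of `V` with `X₁` and the image of `V` in `X₃`, for a short exact
sequence `X₁ ⟶ X₂ ⟶ X₃` and a subobject `V` of `X₂`. -/
noncomputable def subobjectTrace (T : ShortComplex C) (V : Subobject T.X₂) :
    Subobject T.X₁ × Subobject T.X₃ :=
  ((Subobject.pullback T.f).obj V, imageSubobject (V.arrow ≫ T.g))

theorem subobjectTrace_strictMono {T : ShortComplex C} (hT : T.ShortExact) :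
    StrictMono (subobjectTrace T) := by
  intro V V' hV
  have hle := hV.le
  have him : imageSubobject (V.arrow ≫ T.g) ≤ imageSubobject (V'.arrow ≫ T.g) := by
    refine imageSubobject_le _ (Subobject.ofLE _ _ hle ≫ factorThruImageSubobject _) ?_
    rw [Category.assoc, imageSubobject_arrow_comp, Subobject.ofLE_arrow_assoc]
  exact lt_of_le_not_ge ⟨(Subobject.pullback T.f).monotone hle, him⟩ fun hge => hV.ne
    (subobject_eq_of_pullback_le_of_image_le hT hle hge.1 hge.2)

theorem HasFiniteLength.wellFounded {X : C} (h : HasFiniteLength X) :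
    WellFoundedLT (Subobject X) ∧ WellFoundedGT (Subobject X) := by
  refine HasFiniteLength.induction (P := fun X => WellFoundedLT (Subobject X) ∧
    WellFoundedGT (Subobject X)) (fun X hX => ?_) (fun X hX => ?_) (fun T hT h₁ h₃ => ?_) h
  · have := Subobject.subsingleton_of_isZero hX
    exact ⟨inferInstance, inferInstance⟩
  · classical
    have : Finite (Subobject X) := Finite.of_equiv Bool IsSimpleOrder.equivBool.symm
    exact ⟨inferInstance, inferInstance⟩
  · have := h₁.1
    have := h₁.2
    have := h₃.1
    have := h₃.2
    exact ⟨(subobjectTrace_strictMono hT).wellFoundedLT,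
      (subobjectTrace_strictMono hT).wellFoundedGT⟩


/-! ### Sums of semisimple objects, and socles -/

namespace IsSemisimple

theorem isSplitEpi {X Q : C} (hX : IsSemisimple X) (p : X ⟶ Q) [Epi p] : IsSplitEpi p := by
  obtain ⟨⟨r, hr⟩⟩ := hX (kernel.ι p)
  have h0 : kernel.ι p ≫ (𝟙 X - r ≫ kernel.ι p) = 0 := by
    rw [Preadditive.comp_sub, reassoc_of% hr, Category.comp_id, sub_self]
  refine ⟨⟨Abelian.epiDesc p _ h0, ?_⟩⟩
  rw [← cancel_epi p, ← Category.assoc, Abelian.comp_epiDesc, Preadditive.sub_comp,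
    Category.assoc, kernel.condition, comp_zero, sub_zero, Category.id_comp, Category.comp_id]

theorem of_epi {X Q : C} (hX : IsSemisimple X) (p : X ⟶ Q) [Epi p] : IsSemisimple Q := by
  have := hX.isSplitEpi p
  exact hX.of_mono (section_ p)

theorem of_isZero {X : C} (hX : IsZero X) : IsSemisimple X := fun _ i _ =>
  ⟨⟨0, (hX.of_mono i).eq_of_src _ _⟩⟩

theorem of_simple (X : C) [Simple X] : IsSemisimple X := by
  intro B i _
  by_cases h : i = 0
  · subst h
    exact ⟨⟨0, (IsZero.of_mono_zero B X).eq_of_src _ _⟩⟩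
  · have := isIso_of_mono_of_nonzero h
    infer_instance

theorem biprod {X Y : C} (hX : IsSemisimple X) (hY : IsSemisimple Y) : IsSemisimple (X ⊞ Y) := by
  intro B i _
  -- `κ'` is the part of `B` inside `Y`; it has a complement `κ''` in `B`, which embeds into `X`
  let κ' := kernel.ι (i ≫ biprod.fst)
  have hκ' : κ' ≫ i ≫ biprod.fst = 0 := kernel.condition _
  have hm' : Mono (κ' ≫ i ≫ biprod.snd) := by
    refine Preadditive.mono_of_cancel_zero _ fun x hx => ?_
    rw [← cancel_mono κ', ← cancel_mono i, zero_comp, zero_comp]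
    ext
    · simp [hκ']
    · simpa using hx
  obtain ⟨⟨r', hr'⟩⟩ := hY (κ' ≫ i ≫ biprod.snd)
  let e := i ≫ biprod.snd ≫ r'
  have he : κ' ≫ e = 𝟙 _ := by simpa [e] using hr'
  let κ'' := kernel.ι e
  have hκ'' : κ'' ≫ e = 0 := kernel.condition _
  have hm'' : Mono (κ'' ≫ i ≫ biprod.fst) := by
    refine Preadditive.mono_of_cancel_zero _ fun x hx => ?_
    have hx' : (x ≫ κ'') ≫ i ≫ biprod.fst = 0 := by simpa using hx
    have h1 : kernel.lift _ _ hx' ≫ κ' = x ≫ κ'' := kernel.lift_ι _ _ _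
    have h2 : kernel.lift _ _ hx' = 0 := by
      have := congrArg (· ≫ e) h1
      simpa [he, hκ''] using this
    rw [← cancel_mono κ'', ← h1, h2, zero_comp, zero_comp]
  obtain ⟨⟨r'', hr''⟩⟩ := hX (κ'' ≫ i ≫ biprod.fst)
  have hπ : (𝟙 B - e ≫ κ') ≫ e = 0 := by
    rw [Preadditive.sub_comp, Category.assoc, he, Category.comp_id, Category.id_comp, sub_self]
  let π := kernel.lift _ _ hπ
  have hπι : π ≫ κ'' = 𝟙 B - e ≫ κ' := kernel.lift_ι _ _ _
  have hπ' : i ≫ biprod.fst ≫ r'' = π := by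
    have h1 : (π ≫ κ'') ≫ i ≫ biprod.fst ≫ r'' = π := by
      have := congrArg (π ≫ ·) hr''
      simpa using this
    rw [← h1, hπι, Preadditive.sub_comp, Category.id_comp, Category.assoc]
    rw [show κ' ≫ i ≫ biprod.fst ≫ r'' = 0 by
      simpa using congrArg (· ≫ r'') hκ', comp_zero, sub_zero]
  refine ⟨⟨biprod.snd ≫ r' ≫ κ' + biprod.fst ≫ r'' ≫ κ'', ?_⟩⟩
  have h3 : i ≫ biprod.fst ≫ r'' ≫ κ'' = 𝟙 B - e ≫ κ' := by
    rw [← hπι, ← hπ']; simp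
  rw [Preadditive.comp_add, h3]
  simp [e]

end IsSemisimple

/-- An object of finite length has a largest semisimple subobject, which is also the least upper
bound of the simple subobjects; so the chosen `socle` is not the junk value `⊥`. -/
theorem exists_isLUB_simple {X : C} (h : HasFiniteLength X) :
    ∃ M : Subobject X, IsLUB {V : Subobject X | Simple (V : C)} M ∧
      ∀ ⦃Q : C⦄ (_ : IsSemisimple Q) (q : Q ⟶ X), M.Factors q := by
  obtain ⟨h₁, h₂⟩ := h.wellFounded
  obtain ⟨M, hM, hmax⟩ := WellFounded.has_min (wellFounded_gt (α := Subobject X))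
    {V : Subobject X | IsSemisimple (V : C)}
    ⟨⊥, IsSemisimple.of_isZero ((isZero_zero C).of_iso Subobject.botCoeIsoZero)⟩
  have hfac : ∀ ⦃Q : C⦄ (_ : IsSemisimple Q) (q : Q ⟶ X), M.Factors q := by
    intro Q hQ q
    -- the sum of `M` and the image of `q`, as a quotient of the semisimple object `M ⊞ Q`
    let f := Limits.biprod.desc M.arrow q
    have hss : IsSemisimple (imageSubobject f : C) :=
      (hM.biprod hQ).of_epi (factorThruImageSubobject f)
    have hle : M ≤ imageSubobject f :=
      Subobject.le_of_comm (Limits.biprod.inl ≫ factorThruImageSubobject f) (by simp [f])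
    have heq : M = imageSubobject f := by
      by_contra hne
      exact hmax _ hss (lt_of_le_of_ne hle hne)
    rw [heq]
    have : q = (Limits.biprod.inr ≫ factorThruImageSubobject f) ≫ (imageSubobject f).arrow := by
      simp [f]
    rw [this]
    exact Subobject.factors_comp_arrow _
  refine ⟨M, ⟨fun V hV => ?_, fun U hU => ?_⟩, hfac⟩
  · have : Simple (V : C) := hV
    exact Subobject.le_of_comm _ (M.factorThru_arrow _ (hfac (IsSemisimple.of_simple _) V.arrow))
  -- if `M ⟶ X / U` had a nonzero image, that image would be a summand of `M`, and would contain
  -- a simple subobject of `M` that does not lie in `U`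
  · let q := M.arrow ≫ cokernel.π U.arrow
    have hU' : U.arrow ≫ cokernel.π U.arrow = 0 := cokernel.condition _
    suffices hq : q = 0 by
      have hl := Abelian.monoLift_comp U.arrow M.arrow hq
      exact Subobject.le_of_comm _ hl
    by_contra hq
    have hsplit := IsSemisimple.isSplitEpi hM (factorThruImage q)
    have hart : IsArtinianObject X := ⟨h₁⟩
    have := isArtinianObject_of_mono (section_ (factorThruImage q) ≫ M.arrow)
    have hnz : ¬ IsZero (image q) := fun hz => hq (by
      rw [← image.fac q, hz.eq_of_tgt (factorThruImage q) 0, zero_comp])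
    let t := simpleSubobjectArrow hnz
    let j := t ≫ section_ (factorThruImage q) ≫ M.arrow
    have hle : Subobject.mk j ≤ U := hU
      (show Simple _ from Simple.of_iso (Subobject.underlyingIso j))
    have hj : j = Subobject.ofMkLE j U hle ≫ U.arrow := (Subobject.ofMkLE_arrow hle).symm
    have hs : section_ (factorThruImage q) ≫ q = image.ι q := by
      calc section_ (factorThruImage q) ≫ q
          = (section_ (factorThruImage q) ≫ factorThruImage q) ≫ image.ι q := by
            rw [Category.assoc, image.fac]
        _ = image.ι q := by rw [IsSplitEpi.id, Category.id_comp]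
    have h0 : t ≫ image.ι q = 0 := by
      have h1 : j ≫ cokernel.π U.arrow = 0 := by rw [hj, Category.assoc, hU', comp_zero]
      rw [← hs, ← h1]
      simp [j, q]
    have ht : t = 0 := by rwa [← cancel_mono (image.ι q), zero_comp]
    exact id_nonzero (simpleSubobject hnz) (by rw [← cancel_mono t, ht, comp_zero, comp_zero])

/-- Morphisms from semisimple objects land in the socle. -/
theorem factors_socle {X Q : C} (h : HasFiniteLength X) (hQ : IsSemisimple Q) (q : Q ⟶ X) :
    (socle X).Factors q := by
  obtain ⟨M, hM, hfac⟩ := exists_isLUB_simple h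
  have hex : ∃ U : Subobject X, IsLUB {V : Subobject X | Simple (V : C)} U := ⟨M, hM⟩
  have : socle X = M := by
    rw [socle, dif_pos hex]
    exact hex.choose_spec.unique hM
  rw [this]
  exact hfac hQ q

/-! ### Loewy filtrations -/

/-- `X` has a filtration of length `m` with semisimple quotients. The top quotient is encoded as the
image of a morphism `p` into a semisimple object, not necessarily epi, and the rest of the
filtration lives on its kernel; in this form the passage to subobjects is immediate. -/
def HasLoewyFiltration : ℕ → C → Prop
  | 0, X => IsZero X
  | m + 1, X => ∃ (Q : C) (p : X ⟶ Q), IsSemisimple Q ∧ HasLoewyFiltration m (kernel p)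

namespace HasLoewyFiltration

theorem of_mono {m : ℕ} {X Y : C} (hY : HasLoewyFiltration m Y) (f : X ⟶ Y) [Mono f] :
    HasLoewyFiltration m X := by
  induction m generalizing X Y with
  | zero => exact IsZero.of_mono f hY
  | succ m ih =>
    obtain ⟨Q, p, hQ, hp⟩ := hY
    let l : kernel (f ≫ p) ⟶ kernel p := kernel.lift _ (kernel.ι _ ≫ f) (by simp)
    have : Mono (l ≫ kernel.ι p) := by
      rw [kernel.lift_ι]; infer_instance
    have := mono_of_mono l (kernel.ι p)
    exact ⟨Q, f ≫ p, hQ, ih hp l⟩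

theorem of_isZero (m : ℕ) {X : C} (hX : IsZero X) : HasLoewyFiltration m X := by
  induction m generalizing X with
  | zero => exact hX
  | succ m ih => exact ⟨X, 𝟙 X, IsSemisimple.of_isZero hX, ih (IsZero.of_mono (kernel.ι _) hX)⟩

theorem succ {m : ℕ} {X : C} (hX : HasLoewyFiltration m X) : HasLoewyFiltration (m + 1) X := by
  induction m generalizing X with
  | zero => exact of_isZero _ hX
  | succ m ih =>
    obtain ⟨Q, p, hQ, hp⟩ := hX
    exact ⟨Q, p, hQ, ih hp⟩

theorem mono_right {m n : ℕ} (h : m ≤ n) {X : C} (hX : HasLoewyFiltration m X) :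
    HasLoewyFiltration n X := by
  induction h with
  | refl => exact hX
  | step _ ih => exact ih.succ

theorem biprod {m : ℕ} {X Y : C} (hX : HasLoewyFiltration m X) (hY : HasLoewyFiltration m Y) :
    HasLoewyFiltration m (X ⊞ Y) := by
  induction m generalizing X Y with
  | zero => exact (biprod_isZero_iff X Y).2 ⟨hX, hY⟩
  | succ m ih =>
    obtain ⟨Q, p, hQ, hp⟩ := hX
    obtain ⟨Q', p', hQ', hp'⟩ := hY
    let f := Limits.biprod.map p p'
    let l : kernel f ⟶ kernel p ⊞ kernel p' := Limits.biprod.lift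
      (kernel.lift _ (kernel.ι f ≫ Limits.biprod.fst) (by
        rw [Category.assoc, ← Limits.biprod.map_fst p p', kernel.condition_assoc, zero_comp]))
      (kernel.lift _ (kernel.ι f ≫ Limits.biprod.snd) (by
        rw [Category.assoc, ← Limits.biprod.map_snd p p', kernel.condition_assoc, zero_comp]))
    have hl : l ≫ Limits.biprod.map (kernel.ι p) (kernel.ι p') = kernel.ι f := by
      ext <;> simp [l]
    have : Mono (l ≫ Limits.biprod.map (kernel.ι p) (kernel.ι p')) := by
      rw [hl]; infer_instance
    have := mono_of_mono l (Limits.biprod.map (kernel.ι p) (kernel.ι p'))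
    exact ⟨Q ⊞ Q', f, hQ.biprod hQ', (ih hp hp').of_mono l⟩

/-- Filtrations of `ker f` and of the target of `f` concatenate. -/
theorem of_kernel {a b : ℕ} {X Y : C} (f : X ⟶ Y) (hf : HasLoewyFiltration a (kernel f))
    (hY : HasLoewyFiltration b Y) : HasLoewyFiltration (a + b) X := by
  induction b generalizing X Y with
  | zero =>
    have hf0 : f = 0 := IsZero.eq_of_tgt hY _ _
    subst hf0
    exact hf.of_mono (kernel.lift (0 : X ⟶ Y) (𝟙 X) comp_zero)
  | succ b ih =>
    obtain ⟨Q, p, hQ, hp⟩ := hY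
    let g : kernel (f ≫ p) ⟶ kernel p := kernel.lift _ (kernel.ι _ ≫ f) (by simp)
    have hg : g ≫ kernel.ι p = kernel.ι (f ≫ p) ≫ f := kernel.lift_ι _ _ _
    let l : kernel g ⟶ kernel f := kernel.lift _ (kernel.ι g ≫ kernel.ι (f ≫ p)) (by
      rw [Category.assoc, ← hg, kernel.condition_assoc, zero_comp])
    have : Mono (l ≫ kernel.ι f) := by
      rw [kernel.lift_ι]; infer_instance
    have := mono_of_mono l (kernel.ι f)
    exact ⟨Q, f ≫ p, hQ, ih g (hf.of_mono l) hp⟩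

theorem of_shortExact {T : ShortComplex C} (hT : T.ShortExact) {a b : ℕ}
    (h₁ : HasLoewyFiltration a T.X₁) (h₃ : HasLoewyFiltration b T.X₃) :
    HasLoewyFiltration (a + b) T.X₂ := by
  have := hT.mono_f
  have hl := hT.exact.lift_f _ (kernel.condition T.g)
  have : Mono (hT.exact.lift _ (kernel.condition T.g) ≫ T.f) := by
    rw [hl]; infer_instance
  have := mono_of_mono (hT.exact.lift _ (kernel.condition T.g)) T.f
  exact of_kernel T.g (h₁.of_mono (hT.exact.lift _ (kernel.condition T.g))) h₃

theorem of_simple (X : C) [Simple X] : HasLoewyFiltration 1 X :=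
  ⟨X, 𝟙 X, IsSemisimple.of_simple X, isZero_kernel_of_mono _⟩

/-- The Loewy series grows at least as fast as any filtration with semisimple quotients: a morphism
from an object with a filtration of length `m` has its image in the `m`-th term. -/
theorem factors_loewySeries (hfl : ∀ X : C, HasFiniteLength X) {m : ℕ} {X Z : C}
    (hZ : HasLoewyFiltration m Z) (g : Z ⟶ X) : (loewySeries X m).Factors g := by
  induction m generalizing Z with
  | zero =>
    rw [IsZero.eq_of_src hZ g 0]
    exact Subobject.factors_zero
  | succ m ih =>
    obtain ⟨Q, p, hQ, hp⟩ := hZ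
    refine pullback_factors _ _ _ ?_
    have h0 : kernel.ι p ≫ g ≫ cokernel.π (loewySeries X m).arrow = 0 := by
      rw [← Category.assoc, ← (loewySeries X m).factorThru_arrow _ (ih hp (kernel.ι p ≫ g)),
        Category.assoc, cokernel.condition, comp_zero]
    have h1 : IsSemisimple (cokernel (kernel.ι p)) := hQ.of_mono (Abelian.factorThruCoimage p)
    rw [← cokernel.π_desc (kernel.ι p) _ h0]
    exact Subobject.factors_of_factors_right _ (factors_socle (hfl _) h1 _)

theorem loewyLength_le (hfl : ∀ X : C, HasFiniteLength X) {m : ℕ} {X : C}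
    (hX : HasLoewyFiltration m X) : loewyLength X ≤ m := by
  refine iInf₂_le m ?_
  have := hX.factors_loewySeries hfl (𝟙 X)
  exact eq_top_iff.2 (Subobject.le_of_comm (Subobject.arrow _ ≫ Subobject.factorThru _ _ this)
    (by simp))

end HasLoewyFiltration

end Abelian

section LinearCategory

open Module

variable (k : Type w) [Field k] {C : Type u} [Category.{v} C] [Abelian C] [Linear k C]

/-! ### Dimensions of `Hom` spaces along composition series -/

section

variable {k}

theorem finrank_le_add_of_ker_le_range {A B D : Type*} [AddCommGroup A] [Module k A]
    [AddCommGroup B] [Module k B] [AddCommGroup D] [Module k D] [FiniteDimensional k A]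
    [FiniteDimensional k B] [FiniteDimensional k D] (f : A →ₗ[k] B) (g : B →ₗ[k] D)
    (h : LinearMap.ker g ≤ LinearMap.range f) : finrank k B ≤ finrank k A + finrank k D := by
  rw [← LinearMap.finrank_range_add_finrank_ker g, add_comm]
  exact add_le_add ((Submodule.finrank_mono h).trans (LinearMap.finrank_range_le f))
    (Submodule.finrank_le _)

theorem add_le_finrank_of_range_le_ker {A B D : Type*} [AddCommGroup A] [Module k A]
    [AddCommGroup B] [Module k B] [AddCommGroup D] [Module k D]
    [FiniteDimensional k B] (f : A →ₗ[k] B) (g : B →ₗ[k] D)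
    (hf : Function.Injective f) (hg : Function.Surjective g)
    (h : LinearMap.range f ≤ LinearMap.ker g) : finrank k A + finrank k D ≤ finrank k B := by
  rw [← LinearMap.finrank_range_add_finrank_ker g, add_comm, LinearMap.range_eq_top.2 hg,
    finrank_top, ← LinearMap.finrank_range_of_inj hf]
  exact Nat.add_le_add_left (Submodule.finrank_mono h) _

theorem finrank_hom_congr_right (W : C) {X Y : C} (e : X ≅ Y) :
    finrank k (W ⟶ X) = finrank k (W ⟶ Y) :=
  (Linear.homCongr k (Iso.refl W) e).finrank_eq

end

variable (hfin : ∀ X Y : C, FiniteDimensional k (X ⟶ Y))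
include hfin

theorem finrank_hom_le_sum_right (Z : C) {Y : C} (s : CompSeries Y) (n : Fin s.length → ℕ)
    (h : ∀ i, finrank k (Z ⟶ s.factor i) ≤ n i) : finrank k (Z ⟶ Y) ≤ ∑ i, n i := by
  refine s.devissage (R := fun Y n => finrank k (Z ⟶ Y) ≤ n) (fun X hX => ?_)
    (fun T hT a b ha hb => ?_) n h
  · have : Subsingleton (Z ⟶ X) := ⟨fun f g => hX.eq_of_tgt f g⟩
    exact (finrank_zero_of_subsingleton).le
  · refine le_trans (finrank_le_add_of_ker_le_range (Linear.rightComp k Z T.f)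
      (Linear.rightComp k Z T.g) fun f hf => ?_) (add_le_add ha hb)
    have := hT.mono_f
    exact ⟨hT.exact.lift f hf, hT.exact.lift_f f hf⟩

theorem finrank_hom_le_sum_left (Z : C) {Y : C} (s : CompSeries Y) (n : Fin s.length → ℕ)
    (h : ∀ i, finrank k (s.factor i ⟶ Z) ≤ n i) : finrank k (Y ⟶ Z) ≤ ∑ i, n i := by
  refine s.devissage (R := fun Y n => finrank k (Y ⟶ Z) ≤ n) (fun X hX => ?_)
    (fun T hT a b ha hb => ?_) n h
  · have : Subsingleton (X ⟶ Z) := ⟨fun f g => hX.eq_of_src f g⟩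
    exact (finrank_zero_of_subsingleton).le
  · refine le_trans (finrank_le_add_of_ker_le_range (Linear.leftComp k Z T.g)
      (Linear.leftComp k Z T.f) fun f hf => ?_) ((add_comm _ _).trans_le (add_le_add ha hb))
    have := hT.epi_g
    exact ⟨hT.exact.desc f hf, hT.exact.g_desc f hf⟩

/-- By Schur's lemma each pair of composition factors contributes at most `1`. -/
theorem finrank_hom_le_mul [IsAlgClosed k] {X Y : C} (s : CompSeries X) (t : CompSeries Y) :
    finrank k (X ⟶ Y) ≤ s.length * t.length := by
  have h1 : ∀ j, finrank k (X ⟶ t.factor j) ≤ s.length := fun j => by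
    refine (finrank_hom_le_sum_left k hfin _ s (fun _ => 1) fun i => ?_).trans (by simp)
    have := hfin (s.factor i) (s.factor i)
    have : Simple (s.factor i) := s.simple i
    have : Simple (t.factor j) := t.simple j
    exact finrank_hom_simple_simple_le_one k _ _
  refine (finrank_hom_le_sum_right k hfin _ t _ h1).trans ?_
  simp [mul_comm]

/-- If `X₁` is injective, then the sequence splits, so that `Hom(W, -)` is exact on it. -/
theorem finrank_hom_add_le (W : C) {T : ShortComplex C} (hT : T.ShortExact) [Injective T.X₁] :
    finrank k (W ⟶ T.X₁) + finrank k (W ⟶ T.X₃) ≤ finrank k (W ⟶ T.X₂) := by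
  have := hT.mono_f
  refine add_le_finrank_of_range_le_ker (Linear.rightComp k W T.f) (Linear.rightComp k W T.g)
    (fun f g hfg => (cancel_mono T.f).1 hfg) (fun f => ?_) ?_
  · let σ := hT.splittingOfInjective
    exact ⟨f ≫ σ.s, by simp [σ.s_g]⟩
  · rintro _ ⟨f, rfl⟩
    simp [T.zero]

end LinearCategory

section Tensor

open Module

variable {C : Type u} [Category.{v} C] [Abelian C] [MonoidalCategory C] [RigidCategory C]

/-! ### Exactness of the tensor product -/

instance mono_whiskerLeft (X : C) {Y Z : C} (f : Y ⟶ Z) [Mono f] : Mono (X ◁ f) := by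
  have := (tensorLeftAdjunction X Xᘁ).rightAdjoint_preservesLimits
  exact inferInstanceAs (Mono ((tensorLeft X).map f))

instance mono_whiskerRight {Y Z : C} (f : Y ⟶ Z) [Mono f] (X : C) : Mono (f ▷ X) := by
  have := (tensorRightAdjunction (ᘁX) X).rightAdjoint_preservesLimits
  exact inferInstanceAs (Mono ((tensorRight X).map f))

instance epi_whiskerLeft (X : C) {Y Z : C} (f : Y ⟶ Z) [Epi f] : Epi (X ◁ f) := by
  have := (tensorLeftAdjunction (ᘁX) X).leftAdjoint_preservesColimits
  exact inferInstanceAs (Epi ((tensorLeft X).map f))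

/-- The functor `X ⊗ -` has the exact left adjoint `Xᘁ ⊗ -`. -/
instance injective_tensor (X E : C) [Injective E] : Injective (X ⊗ E) := by
  have : (tensorLeft Xᘁ).PreservesMonomorphisms :=
    ⟨fun f _ => inferInstanceAs (Mono (Xᘁ ◁ f))⟩
  exact Injective.injective_of_adjoint (tensorLeftAdjunction X Xᘁ) E

/-- The morphism `X ⟶ X ⊗ E` induced by `𝟙 ⟶ E`; it is mono if `ι` is. For injective `E` this
embeds every object into an injective one. -/
noncomputable def unitTensor {E : C} (ι : 𝟙_ C ⟶ E) (X : C) : X ⟶ X ⊗ E :=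
  (ρ_ X).inv ≫ X ◁ ι

instance mono_unitTensor {E : C} (ι : 𝟙_ C ⟶ E) [Mono ι] (X : C) : Mono (unitTensor ι X) := by
  unfold unitTensor
  infer_instance

/-- A composition factor `F` of `W` is a quotient of a subobject of `W`; the embedding of `F` into
the injective object `F ⊗ E` extends from that subobject to `W`. -/
theorem exists_ne_zero_to_factor_tensor {E : C} (ι : 𝟙_ C ⟶ E) [Mono ι] [Injective E] {W : C}
    (s : CompSeries W) (i : Fin s.length) : ∃ f : W ⟶ s.factor i ⊗ E, f ≠ 0 := by
  let p : (s.obj i.succ : C) ⟶ s.factor i := cokernel.π _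
  refine ⟨Injective.factorThru (p ≫ unitTensor ι _) (s.obj i.succ).arrow, fun h0 => ?_⟩
  have h1 := Injective.comp_factorThru (p ≫ unitTensor ι _) (s.obj i.succ).arrow
  rw [h0, comp_zero] at h1
  have : Simple (s.factor i) := s.simple i
  have : Epi p := inferInstanceAs (Epi (cokernel.π _))
  have hp : p = 0 := by rw [← cancel_mono (unitTensor ι _), zero_comp, ← h1]
  exact id_nonzero (s.factor i) (by rw [← cancel_epi p, hp, zero_comp, zero_comp])

variable [MonoidalPreadditive C]

theorem shortExact_tensorLeft (X : C) {T : ShortComplex C} (hT : T.ShortExact) :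
    (T.map (tensorLeft X)).ShortExact := by
  have := (tensorLeftAdjunction X Xᘁ).rightAdjoint_preservesLimits
  have := (tensorLeftAdjunction (ᘁX) X).leftAdjoint_preservesColimits
  exact hT.map_of_exact (tensorLeft X)

theorem shortExact_tensorRight (X : C) {T : ShortComplex C} (hT : T.ShortExact) :
    (T.map (tensorRight X)).ShortExact := by
  have := (tensorRightAdjunction (ᘁX) X).rightAdjoint_preservesLimits
  have := (tensorRightAdjunction X Xᘁ).leftAdjoint_preservesColimits
  exact hT.map_of_exact (tensorRight X)

/-! ### Simplicity of the unit object -/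

/-- Morphisms `Xᘁ ⟶ Z` correspond to morphisms `𝟙 ⟶ X ⊗ Z`, under which precomposition with `fᘁ`
becomes postcomposition with the monomorphism `f ▷ Z`. -/
theorem epi_rightAdjointMate {X Y : C} [HasRightDual X] [HasRightDual Y] (f : X ⟶ Y)
    [Mono f] : Epi (fᘁ) := by
  refine Preadditive.epi_of_cancel_zero _ fun {Z} g hg => ?_
  have h1 : (η_ X Xᘁ ≫ X ◁ g) ≫ f ▷ Z = 0 := by
    rw [Category.assoc, whisker_exchange, ← Category.assoc,
      ← coevaluation_comp_rightAdjointMate, Category.assoc, ← MonoidalCategory.whiskerLeft_comp, hg,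
      MonoidalPreadditive.whiskerLeft_zero, comp_zero]
  have h2 : η_ X Xᘁ ≫ X ◁ g = 0 := by rwa [← cancel_mono (f ▷ Z), zero_comp]
  have h3 := tensorLeftHomEquiv_symm_coevaluation_comp_whiskerLeft (Y := X) (Y' := Xᘁ) g
  rw [h2] at h3
  have h4 : (tensorLeftHomEquiv (𝟙_ C) X Xᘁ Z).symm 0 = 0 := by
    simp [tensorLeftHomEquiv]
  rw [h4] at h3
  rw [← cancel_epi (ρ_ Xᘁ).hom, ← h3, comp_zero]

theorem coevaluation_ne_zero {X : C} (hX : ¬ IsZero X) : η_ X Xᘁ ≠ 0 := fun h => hX (by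
  rw [IsZero.iff_id_eq_zero]
  have := ExactPairing.evaluation_coevaluation X Xᘁ
  rw [h, MonoidalPreadditive.zero_whiskerRight, zero_comp] at this
  rw [← cancel_epi (λ_ X).hom, ← cancel_mono (ρ_ X).inv, Category.assoc, Category.id_comp, ← this]
  simp)

/-- For a simple subobject `X` of the unit, the dual `𝟙 ⟶ X^*` of the inclusion is epi, so that
`X = X ⊗ 𝟙 ⟶ X ⊗ X^*` is an isomorphism; the coevaluation then gives a morphism `𝟙 ⟶ X`. -/
theorem simple_unit {k : Type w} [Field k] [Linear k C]
    (hend : Function.Bijective (fun c : k => c • 𝟙 (𝟙_ C))) (hfl : HasFiniteLength (𝟙_ C)) :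
    Simple (𝟙_ C) := by
  have hnz : ¬ IsZero (𝟙_ C) := fun h => by
    have : (1 : k) = 0 := hend.1 (h.eq_of_src _ _)
    exact one_ne_zero this
  have : IsArtinianObject (𝟙_ C) := ⟨hfl.wellFounded.1⟩
  let X := simpleSubobject hnz
  let i : X ⟶ 𝟙_ C := simpleSubobjectArrow hnz
  have hη := coevaluation_ne_zero (Simple.not_isZero X)
  have := epi_rightAdjointMate i
  have : Epi (X ◁ iᘁ) := epi_whiskerLeft X (iᘁ)
  -- the right dual of the unit is here, definitionally, the unit
  let e : X ≅ X ⊗ (𝟙_ C)ᘁ := (ρ_ X).symm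
  have : Simple (X ⊗ (𝟙_ C)ᘁ) := Simple.of_iso e.symm
  have hne : X ◁ iᘁ ≠ 0 := fun h => hη (by
    have : 𝟙 (X ⊗ Xᘁ) = 0 := by rw [← cancel_epi (X ◁ iᘁ), h, zero_comp, zero_comp]
    rw [← Category.comp_id (η_ X Xᘁ), this, comp_zero])
  have := isIso_of_epi_of_nonzero hne
  let h : 𝟙_ C ⟶ X := η_ X Xᘁ ≫ inv (X ◁ iᘁ) ≫ e.inv
  have hh : h ≫ i ≠ 0 := fun h0 => hη (by
    have : h = 0 := by rwa [← cancel_mono i, zero_comp]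
    rw [← cancel_mono (inv (X ◁ iᘁ) ≫ e.inv), zero_comp]
    exact this)
  obtain ⟨c, hc⟩ := hend.2 (h ≫ i)
  have hc0 : c ≠ 0 := by
    rintro rfl
    exact hh (by rw [← hc]; simp)
  have : Epi i := by
    refine Preadditive.epi_of_cancel_zero _ fun g hg => ?_
    have h1 : (c • 𝟙 (𝟙_ C)) ≫ g = 0 := by
      dsimp only at hc
      rw [hc, Category.assoc, hg, comp_zero]
    rw [Linear.smul_comp, Category.id_comp] at h1
    exact (smul_eq_zero.1 h1).resolve_left hc0
  have := isIso_of_mono_of_epi i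
  exact Simple.of_iso (asIso i).symm

/-! ### Amplification of the length -/

section Growth

variable {k : Type w} [Field k] [Linear k C]

section

variable [MonoidalLinear k C]

theorem finrank_hom_tensorRight_le {X Y Z : C} [FiniteDimensional k (X ⟶ Z ⊗ Yᘁ)] :
    finrank k (X ⊗ Y ⟶ Z) ≤ finrank k (X ⟶ Z ⊗ Yᘁ) := by
  let F : (X ⊗ Y ⟶ Z) →ₗ[k] (X ⟶ Z ⊗ Yᘁ) :=
    { toFun := tensorRightHomEquiv X Y Yᘁ Z
      map_add' := fun f g => by simp [tensorRightHomEquiv]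
      map_smul' := fun c f => by simp [tensorRightHomEquiv] }
  exact LinearMap.finrank_le_finrank_of_injective (f := F) (tensorRightHomEquiv X Y Yᘁ Z).injective

theorem finrank_hom_tensorLeft_le {X Y Z : C} [FiniteDimensional k (Yᘁ ⊗ X ⟶ Z)] :
    finrank k (X ⟶ Y ⊗ Z) ≤ finrank k (Yᘁ ⊗ X ⟶ Z) := by
  let F : (X ⟶ Y ⊗ Z) →ₗ[k] (Yᘁ ⊗ X ⟶ Z) :=
    { toFun := (tensorLeftHomEquiv X Y Yᘁ Z).symm
      map_add' := fun f g => by simp [tensorLeftHomEquiv]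
      map_smul' := fun c f => by simp [tensorLeftHomEquiv] }
  exact LinearMap.finrank_le_finrank_of_injective (f := F)
    (tensorLeftHomEquiv X Y Yᘁ Z).symm.injective

end

variable (hfin : ∀ X Y : C, FiniteDimensional k (X ⟶ Y)) {E : C} [Injective E]
include hfin

/-- Each composition factor `F` of `W` contributes at least `1` to `Hom(W, W ⊗ E)`, because
`Hom(W, F ⊗ E)` is nonzero and `Hom(W, - ⊗ E)` is exact. -/
theorem length_le_finrank_hom_tensor (ι : 𝟙_ C ⟶ E) [Mono ι] {W : C} (s : CompSeries W) :
    s.length ≤ finrank k (W ⟶ W ⊗ E) := by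
  have h := s.devissage (R := fun Y n => n ≤ finrank k (W ⟶ Y ⊗ E)) (fun _ _ => Nat.zero_le _)
    (fun T hT a b ha hb => ?_) (fun _ => 1) fun i => ?_
  · simpa using h
  · have : Injective (T.map (tensorRight E)).X₁ := injective_tensor T.X₁ E
    exact (add_le_add ha hb).trans (finrank_hom_add_le k hfin W (shortExact_tensorRight E hT))
  · have := hfin W (s.factor i ⊗ E)
    obtain ⟨f, hf⟩ := exists_ne_zero_to_factor_tensor ι s i
    exact finrank_pos_iff_exists_ne_zero.2 ⟨f, hf⟩

/-- Each composition factor of `Y` isomorphic to `S` contributes `dim Hom(W, (S ⊗ T) ⊗ E)` to the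
right side, `Hom(W, (- ⊗ T) ⊗ E)` being exact, and there are at least `dim Hom(S, Y)` such
factors. -/
theorem mul_finrank_hom_le [IsAlgClosed k] (W S T : C) [Simple S] {Y : C} (s : CompSeries Y) :
    finrank k (W ⟶ (S ⊗ T) ⊗ E) * finrank k (S ⟶ Y) ≤ finrank k (W ⟶ (Y ⊗ T) ⊗ E) := by
  classical
  let μ : Fin s.length → ℕ := fun i => if Nonempty (S ≅ s.factor i) then 1 else 0
  have h1 : finrank k (S ⟶ Y) ≤ ∑ i, μ i := finrank_hom_le_sum_right k hfin S s μ fun i => by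
    have : Simple (s.factor i) := s.simple i
    rw [finrank_hom_simple_simple k]
  have h2 : ∑ i, finrank k (W ⟶ (S ⊗ T) ⊗ E) * μ i ≤ finrank k (W ⟶ (Y ⊗ T) ⊗ E) := by
    refine s.devissage (R := fun Y n => n ≤ finrank k (W ⟶ (Y ⊗ T) ⊗ E))
      (fun _ _ => Nat.zero_le _) (fun D hD a b ha hb => ?_) _ fun i => ?_
    · have : Injective ((D.map (tensorRight T)).map (tensorRight E)).X₁ :=
        injective_tensor (D.X₁ ⊗ T) E
      exact (add_le_add ha hb).trans (finrank_hom_add_le k hfin W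
        (shortExact_tensorRight E (shortExact_tensorRight T hD)))
    · by_cases h : Nonempty (S ≅ s.factor i)
      · obtain ⟨e⟩ := h
        have hμ : μ i = 1 := if_pos ⟨e⟩
        rw [hμ, mul_one]
        exact (finrank_hom_congr_right W (whiskerRightIso (whiskerRightIso e T) E)).le
      · have hμ : μ i = 0 := if_neg h
        simp [hμ]
  rw [← Finset.mul_sum] at h2
  exact (Nat.mul_le_mul_left _ h1).trans h2

/-- The amplification step: with `A = (T ⊗ E) ⊗ Tᘁ`, passing from `Y` to `Y ⊗ A` multiplies
`dim Hom(S, -)` by at least the length of `S ⊗ T`. -/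
theorem pow_length_le_finrank [IsAlgClosed k] [MonoidalLinear k C]
    (hfl : ∀ X : C, HasFiniteLength X)
    (ι : 𝟙_ C ⟶ E) [Mono ι] (S T : C) [Simple S] (s : CompSeries (S ⊗ T)) (m : ℕ) :
    s.length ^ m ≤ finrank k (S ⟶ S ⊗ tensorPow ((T ⊗ E) ⊗ Tᘁ) m) := by
  set A := (T ⊗ E) ⊗ Tᘁ with hA
  induction m with
  | zero =>
    have := hfin S (S ⊗ tensorPow A 0)
    refine finrank_pos_iff_exists_ne_zero.2 ⟨(ρ_ S).inv, fun h => id_nonzero S ?_⟩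
    have h' : (ρ_ S).inv = 0 := h
    rw [← cancel_mono (ρ_ S).inv, h', comp_zero, comp_zero]
  | succ m ih =>
    let Y := S ⊗ tensorPow A m
    obtain ⟨t⟩ := hfl Y
    have := hfin S (((Y ⊗ T) ⊗ E) ⊗ Tᘁ)
    let e : ((Y ⊗ T) ⊗ E) ⊗ Tᘁ ≅ S ⊗ tensorPow A (m + 1) :=
      whiskerRightIso (α_ Y T E) Tᘁ ≪≫ α_ Y (T ⊗ E) Tᘁ ≪≫ α_ S (tensorPow A m) A
    calc s.length ^ (m + 1) = s.length * s.length ^ m := pow_succ' _ _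
      _ ≤ finrank k (S ⊗ T ⟶ (S ⊗ T) ⊗ E) * finrank k (S ⟶ Y) :=
        Nat.mul_le_mul (length_le_finrank_hom_tensor hfin ι s) ih
      _ ≤ finrank k (S ⊗ T ⟶ (Y ⊗ T) ⊗ E) := mul_finrank_hom_le hfin (S ⊗ T) S T t
      _ ≤ finrank k (S ⟶ ((Y ⊗ T) ⊗ E) ⊗ Tᘁ) := finrank_hom_tensorRight_le
      _ = finrank k (S ⟶ S ⊗ tensorPow A (m + 1)) := finrank_hom_congr_right S e

end Growth

end Tensor

/-! ### Loewy filtrations of bounded length -/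

theorem le_of_eventually_pow_le {a c K : ℝ} (hK : 1 ≤ K)
    (h : ∀ᶠ m : ℕ in Filter.atTop, a ^ m ≤ c * K ^ m) : a ≤ K := by
  by_contra! hlt
  have hK0 : 0 < K := by linarith
  have h1 := tendsto_pow_atTop_atTop_of_one_lt ((one_lt_div hK0).2 hlt)
  obtain ⟨m, hm, hm'⟩ := (h.and (h1.eventually_gt_atTop c)).exists
  rw [div_pow, lt_div_iff₀ (pow_pos hK0 m)] at hm'
  exact absurd hm (not_le.2 hm')

section Main

open Module

variable {k : Type w} [Field k] [IsAlgClosed k] {C : Type u} [Category.{v} C] [Abelian C]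
  [Linear k C] [MonoidalCategory C] [MonoidalPreadditive C] [MonoidalLinear k C] [RigidCategory C]
  (hfl : ∀ X : C, HasFiniteLength X) (hfin : ∀ X Y : C, FiniteDimensional k (X ⟶ Y))

include hfin hfl in
/-- The length of `S ⊗ T` is bounded independently of the simple object `S`. -/
theorem length_le_spectralRadius (hgrowth : HasSubexponentialGrowth C) {E : C} [Injective E]
    (ι : 𝟙_ C ⟶ E) [Mono ι] (S T : C) [Simple S] (s : CompSeries (S ⊗ T)) :
    (s.length : ℝ) ≤ FrobeniusTensor.spectralRadius ((T ⊗ E) ⊗ Tᘁ) := by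
  refine le_csInf (hgrowth _) fun K hK => ?_
  obtain ⟨t⟩ := hfl (Sᘁ ⊗ S)
  refine le_of_eventually_pow_le (c := t.length) hK.1 (hK.2.mono fun m hm => ?_)
  set P := tensorPow ((T ⊗ E) ⊗ Tᘁ) m
  have hP : (Classical.choice (hfl P)).length = length P := by
    rw [length, dif_pos (hfl P)]
  have := hfin (Sᘁ ⊗ S) P
  have h : s.length ^ m ≤ t.length * length P := calc
    s.length ^ m ≤ finrank k (S ⟶ S ⊗ P) := pow_length_le_finrank hfin hfl ι S T s m
    _ ≤ finrank k (Sᘁ ⊗ S ⟶ P) := finrank_hom_tensorLeft_le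
    _ ≤ t.length * length P := by
      rw [← hP]
      exact finrank_hom_le_mul k hfin t _
  calc (s.length : ℝ) ^ m ≤ t.length * length P := by exact_mod_cast h
    _ ≤ t.length * K ^ m := by gcongr

/-- If every simple object embeds into an injective object with a Loewy filtration of length `m`,
then so does every object, by the horseshoe construction. -/
theorem hasLoewyFiltration_of_simple {C : Type u} [Category.{v} C] [Abelian C] {m : ℕ}
    (h : ∀ S : C, Simple S → ∃ (J : C) (i : S ⟶ J), Mono i ∧ Injective J ∧ HasLoewyFiltration m J)
    {X : C} (hX : HasFiniteLength X) : HasLoewyFiltration m X := by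
  have key : ∃ (J : C) (i : X ⟶ J), Mono i ∧ Injective J ∧ HasLoewyFiltration m J := by
    refine HasFiniteLength.induction (P := fun X => ∃ (J : C) (i : X ⟶ J), Mono i ∧ Injective J ∧
      HasLoewyFiltration m J) (fun X hX => ?_) h (fun T hT h₁ h₃ => ?_) hX
    · exact ⟨X, 𝟙 X, inferInstance, hX.injective, HasLoewyFiltration.of_isZero m hX⟩
    · obtain ⟨J₁, i₁, _, _, hJ₁⟩ := h₁
      obtain ⟨J₃, i₃, _, _, hJ₃⟩ := h₃
      have := hT.mono_f
      refine ⟨J₁ ⊞ J₃, biprod.lift (Injective.factorThru i₁ T.f) (T.g ≫ i₃), ?_, inferInstance,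
        hJ₁.biprod hJ₃⟩
      refine Preadditive.mono_of_cancel_zero _ fun x hx => ?_
      have hx₁ : x ≫ Injective.factorThru i₁ T.f = 0 := by
        simpa using congrArg (· ≫ biprod.fst) hx
      have hx₃ : x ≫ T.g = 0 := by
        rw [← cancel_mono i₃, Category.assoc, zero_comp]
        simpa using congrArg (· ≫ biprod.snd) hx
      have hl := hT.exact.lift_f x hx₃
      have hl0 : hT.exact.lift x hx₃ = 0 := by
        rw [← cancel_mono i₁, zero_comp, ← Injective.comp_factorThru i₁ T.f, ← Category.assoc, hl,
          hx₁]
      rw [← hl, hl0, zero_comp]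
  obtain ⟨J, i, _, _, hJ⟩ := key
  exact hJ.of_mono i

include hfin hfl in
/-- The injective objects `S ⊗ E`, for `S` simple, are filtered by the objects `S ⊗ T j`, where
`T j` runs through the composition factors of `E`; the lengths of these are bounded
independently of `S`. The factors are given up to isomorphism, so that chosen representatives may be
used for them. -/
theorem hasLoewyFiltration_floor (hgrowth : HasSubexponentialGrowth C) {E : C} [Injective E]
    (ι : 𝟙_ C ⟶ E) [Mono ι] (s : CompSeries E) (T : Fin s.length → C)
    (hT : ∀ j, Nonempty (s.factor j ≅ T j)) (X : C) :
    HasLoewyFiltration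
      ⌊∑ j, FrobeniusTensor.spectralRadius ((T j ⊗ E) ⊗ (T j)ᘁ)⌋₊ X := by
  refine hasLoewyFiltration_of_simple (fun S hS => ?_) (hfl X)
  refine ⟨S ⊗ E, unitTensor ι S, inferInstance, inferInstance, ?_⟩
  let t : ∀ j, CompSeries (S ⊗ T j) := fun j => Classical.choice (hfl _)
  have h : HasLoewyFiltration (∑ j, (t j).length) (S ⊗ E) := by
    refine s.devissage (R := fun Y n => HasLoewyFiltration n (S ⊗ Y)) (fun Z hZ => ?_)
      (fun D hD a b ha hb => ?_) _ fun j => ?_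
    · exact (tensorLeft S).map_isZero hZ
    · exact HasLoewyFiltration.of_shortExact (shortExact_tensorLeft S hD) ha hb
    · obtain ⟨e⟩ := hT j
      have h1 : HasLoewyFiltration (∑ _ : Fin (t j).length, 1) (S ⊗ T j) :=
        (t j).devissage (R := fun Y n => HasLoewyFiltration n Y) (fun Z hZ => hZ)
          (fun D hD a b ha hb => ha.of_shortExact hD hb) _ fun i =>
            have : Simple ((t j).factor i) := (t j).simple i
            HasLoewyFiltration.of_simple ((t j).factor i)
      rw [Finset.sum_const, Finset.card_univ, Fintype.card_fin, smul_eq_mul, mul_one] at h1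
      exact h1.of_mono (S ◁ e.hom)
  refine h.mono_right (Nat.le_floor ?_)
  push_cast
  exact Finset.sum_le_sum fun j _ => length_le_spectralRadius hfl hfin hgrowth ι S (T j) (t j)

end Main

end FrobeniusTensor

open FrobeniusTensor in
theorem mainTheorem3 {k : Type w} [Field k] [IsAlgClosed k]
    {C : Type u} [Category.{v} C] [Abelian C] [Linear k C] [MonoidalCategory C]
    [MonoidalPreadditive C] [MonoidalLinear k C] [RigidCategory C]
    [IsFrobeniusTensorCategory C k]
    (hgrowth : HasSubexponentialGrowth C) :
    CoradicalFiltrationFinite C ∧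
      (∃ (E : C) (ι : 𝟙_ C ⟶ E), IsInjectiveHull ι) ∧
      ∀ (E : C) (ι : 𝟙_ C ⟶ E), IsInjectiveHull ι →
        ∀ (I : Type*) (S : I → C), IsSimpleRepresentatives S →
          {i : I | multiplicity E (S i) ≠ 0}.Finite ∧
          ∃ N : ℕ, categoryLoewyLength C = N ∧
            (N : ℝ) ≤ ∑ᶠ i : I, (multiplicity E (S i) : ℝ) *
              FrobeniusTensor.spectralRadius ((S i ⊗ E) ⊗ (S i)ᘁ) := by
  have hart : IsArtinianCategory C k :=
    (inferInstance : IsFrobeniusTensorCategory C k).toIsArtinianCategory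
  have hfl := hart.finite_length
  have hfin := hart.finite_hom
  have hsimple : Simple (𝟙_ C) :=
    simple_unit (k := k) (inferInstance : IsFrobeniusTensorCategory C k).end_unit (hfl _)
  obtain ⟨E₀, ι₀, h₀⟩ :=
    (inferInstance : IsFrobeniusTensorCategory C k).injective_hulls (𝟙_ C) hsimple
  refine ⟨?_, ⟨E₀, ι₀, h₀⟩, fun E ι hι I S hS => ?_⟩
  · have := h₀.mono
    have := h₀.injective
    obtain ⟨s⟩ := hfl E₀
    exact ⟨_, fun X => ((hasLoewyFiltration_floor hfl hfin hgrowth ι₀ s s.factor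
      (fun j => ⟨Iso.refl _⟩) X).loewyLength_le hfl).trans le_self_add⟩
  · classical
    have := hι.mono
    have := hι.injective
    let s := Classical.choice (hfl E)
    -- `S (c j)` represents the `j`-th factor of the composition series of `E` that defines the
    -- multiplicities, so that `multiplicity E (S i)` is the size of the fibre of `c` over `i`
    choose c hc huniq using fun j => hS.existsUnique (s.factor j) (s.simple j)
    have hmult : ∀ i, multiplicity E (S i) = (Finset.univ.filter fun j => c j = i).card := by
      intro i
      rw [FrobeniusTensor.multiplicity, dif_pos (hfl E), Nat.card_eq_fintype_card,
        Fintype.card_subtype]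
      congr 1
      ext j
      simp only [Finset.mem_filter, Finset.mem_univ, true_and]
      exact ⟨fun h => (huniq j i h).symm, fun h => h ▸ hc j⟩
    have hsub : ∀ i, multiplicity E (S i) ≠ 0 → i ∈ Finset.univ.image c := by
      intro i hi
      rw [hmult, Finset.card_ne_zero] at hi
      obtain ⟨j, hj⟩ := hi
      exact Finset.mem_image.2 ⟨j, Finset.mem_univ _, (Finset.mem_filter.1 hj).2⟩
    refine ⟨(Finset.univ.image c).finite_toSet.subset hsub, ?_⟩
    set ρ : I → ℝ := fun i => FrobeniusTensor.spectralRadius ((S i ⊗ E) ⊗ (S i)ᘁ)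
    have hsum : ∑ᶠ i, (multiplicity E (S i) : ℝ) * ρ i = ∑ j, ρ (c j) := by
      rw [finsum_eq_sum_of_support_subset (s := Finset.univ.image c) _ fun i hi =>
        hsub i fun h0 => hi (by simp [h0])]
      rw [← Finset.sum_fiberwise_of_maps_to (g := c) (t := Finset.univ.image c)
        fun j _ => Finset.mem_image_of_mem c (Finset.mem_univ j)]
      refine Finset.sum_congr rfl fun i _ => ?_
      rw [Finset.sum_congr rfl fun j hj => congrArg ρ (Finset.mem_filter.1 hj).2,
        Finset.sum_const, nsmul_eq_mul, hmult]
    have hle : categoryLoewyLength C ≤ (⌊∑ j, ρ (c j)⌋₊ : ℕ) := iSup_le fun X =>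
      (hasLoewyFiltration_floor hfl hfin hgrowth ι s (fun j => S (c j)) hc X).loewyLength_le hfl
    obtain ⟨N, hN⟩ := ENat.ne_top_iff_exists.1 (ne_top_of_le_ne_top (ENat.natCast_ne_top _) hle)
    refine ⟨N, hN.symm, ?_⟩
    rw [← hN, Nat.cast_le] at hle
    rw [hsum]
    have hnonneg : 0 ≤ ∑ j, ρ (c j) := Finset.sum_nonneg fun j _ =>
      Real.sInf_nonneg fun K hK => zero_le_one.trans hK.1
    exact (Nat.cast_le.2 hle).trans (Nat.floor_le hnonneg)
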